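/- Let $(X,d)$ be a proper, roughly geodesic, $\epsilon$-strongly hyperbolic metric space ($\epsilon>0$), i.e. $e^{-\epsilon(x,y)_o}\le e^{-\epsilon(x,z)_o}+e^{-\epsilon(z,y)_o}$ for all $x,y,z,o\in X$, where $(x,y)_o=\frac12(d(x,o)+d(y,o)-d(x,y))$ is the Gromov product; roughly geodesic means that there is $C_X>0$ such that any two points $x,y$ are joined by a map $r:[a,b]\to X$, $r(a)=x$, $r(b)=y$, with $|t-u|-C_X\le d(r(t),r(u))\le |t-u|+C_X$ for all $t,u\in[a,b]$. Let $\Gamma$ be a group acting by isometries, properly discontinuously and cocompactly on $X$, and let $o\in X$ be a base point. Assume that $\Gamma$ is nonelementary, i.e. that its limit set in the Gromov boundary $\partial X$ has more than two points. Put $|\gamma|=d(o,\gamma o)$, let $$\alpha=\limsup_{R\to+\infty}\frac1R\log\bigl|\Gamma o\cap B(o,R)\bigr|$$ be the volume growth, where $B(o,R)$ is the closed ball, and let $\nu_o$ be the Patterson–Sullivan measure on $\partial X$, that is, the $\frac{\alpha}{\epsilon}$-dimensional Hausdorff measure of $\partial X$ for the visual metric $d_{o,\epsilon}(\xi,\eta)=e^{-\epsilon(\xi,\eta)_o}$,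 normalized to have total mass $1$. For $s\in[0,1]$ and $\gamma\in\Gamma$ let $$(\pi_s(\gamma)v)(\xi)=\Bigl(\frac{d\gamma_*\nu_o}{d\nu_o}(\xi)\Bigr)^{s}\,v(\gamma^{-1}\xi),\qquad v\in L^2(\partial X,\nu_o).$$ Then for every $s\in[0,\frac12)\cup(\frac12,1]$ these formulas define a representation $\pi_s$ of $\Gamma$ by bounded operators on $L^2(\partial X,\nu_o)$, and $\pi_s$ is a slow growth representation of $\alpha|\frac12-s|$-exponential type: $\alpha|\frac12-s|>0$, and there is a constant $C>0$ such that $$\|\pi_s(\gamma)\|_{op}\le C\,e^{\alpha|\frac12-s|\,|\gamma|}\qquad\text{for all }\gamma\in\Gamma .$$ -/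

import Mathlib

open Filter Topology MeasureTheory
open scoped ENNReal

noncomputable section

/-! ### Gromov products and strong hyperbolicity -/

/-- The Gromov product `(x, y)_o`. -/
def gromovProduct {X : Type*} [MetricSpace X] (o x y : X) : ℝ :=
  (dist x o + dist y o - dist x y) / 2

/-- `X` is `ε`-strongly hyperbolic. -/
structure IsStronglyHyperbolic (X : Type*) [MetricSpace X] (ε : ℝ) : Prop where
  pos : 0 < ε
  exp_le : ∀ x y z o : X, Real.exp (-ε * gromovProduct o x y) ≤
    Real.exp (-ε * gromovProduct o x z) + Real.exp (-ε * gromovProduct o z y)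

/-- `X` is roughly geodesic: any two points are joined by a rough isometry of a real interval,
with a uniform additive constant. -/
def IsRoughlyGeodesic (X : Type*) [MetricSpace X] : Prop :=
  ∃ C : ℝ, 0 < C ∧ ∀ x y : X, ∃ (a b : ℝ) (r : ℝ → X), a ≤ b ∧ r a = x ∧ r b = y ∧
    ∀ t ∈ Set.Icc a b, ∀ u ∈ Set.Icc a b,
      |t - u| - C ≤ dist (r t) (r u) ∧ dist (r t) (r u) ≤ |t - u| + C

section GromovProduct

variable {X : Type*} [MetricSpace X]

lemma gromovProduct_comm (o x y : X) : gromovProduct o x y = gromovProduct o y x := by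
  unfold gromovProduct; rw [dist_comm x y]; ring

lemma gromovProduct_smul_ge {Γ : Type*} [Group Γ] [MulAction Γ X] [IsIsometricSMul Γ X]
    (γ : Γ) (o x y : X) :
    gromovProduct o x y - dist (γ • o) o ≤ gromovProduct o (γ • x) (γ • y) := by
  unfold gromovProduct
  have h1 : dist x o ≤ dist (γ • x) o + dist (γ • o) o := by
    rw [← dist_smul γ x o, dist_comm (γ • o) o]; exact dist_triangle _ _ _
  have h2 : dist y o ≤ dist (γ • y) o + dist (γ • o) o := by
    rw [← dist_smul γ y o, dist_comm (γ • o) o]; exact dist_triangle _ _ _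
  rw [dist_smul]
  linarith

lemma IsStronglyHyperbolic.tendsto_exp_iff {ε : ℝ} (h : IsStronglyHyperbolic X ε)
    {ι : Type*} {l : Filter ι} (f : ι → ℝ) :
    Tendsto f l atTop ↔ Tendsto (fun i => Real.exp (-ε * f i)) l (𝓝 0) := by
  have e1 : Tendsto (fun i => Real.exp (-ε * f i)) l (𝓝 0) ↔
      Tendsto (fun i => -ε * f i) l atBot := Real.tendsto_exp_comp_nhds_zero
  rw [e1, tendsto_const_mul_atBot_of_neg (neg_lt_zero.mpr h.pos)]

lemma IsStronglyHyperbolic.abs_exp_sub_le {ε : ℝ} (h : IsStronglyHyperbolic X ε)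
    (o x x' y y' : X) :
    |Real.exp (-ε * gromovProduct o x y) - Real.exp (-ε * gromovProduct o x' y')| ≤
      Real.exp (-ε * gromovProduct o x x') + Real.exp (-ε * gromovProduct o y y') := by
  have h1 := h.exp_le x y x' o
  have h2 := h.exp_le x' y y' o
  have h3 := h.exp_le x' y' x o
  have h4 := h.exp_le x y' y o
  rw [gromovProduct_comm o y' y] at h2
  rw [gromovProduct_comm o x' x] at h3
  rw [abs_le]; constructor <;> linarith

end GromovProduct

/-! ### The Gromov boundary -/

/-- Sequences of `X` that converge at infinity. -/
def GromovSeq {X : Type*} [MetricSpace X] (o : X) : Type _ :=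
  {a : ℕ → X // Tendsto (fun p : ℕ × ℕ => gromovProduct o (a p.1) (a p.2)) atTop atTop}

section Boundary

variable {X : Type*} [MetricSpace X] {ε : ℝ}

lemma tendsto_prodMk_swap_of {f : ℕ × ℕ → ℝ} {l : Filter ℝ} (hf : Tendsto f atTop l) :
    Tendsto (fun p : ℕ × ℕ => f (p.2, p.1)) atTop l := by
  refine hf.comp ?_
  rw [← prod_atTop_atTop_eq]
  exact tendsto_snd.prodMk tendsto_fst

lemma tendsto_atTop_diag {f : ℕ × ℕ → ℝ} {l : Filter ℝ} (hf : Tendsto f atTop l) :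
    Tendsto (fun n : ℕ => f (n, n)) atTop l := by
  refine hf.comp ?_
  rw [← prod_atTop_atTop_eq]
  exact tendsto_id.prodMk tendsto_id

lemma tendsto_prod_fst {f : ℕ → ℝ} {l : Filter ℝ} (hf : Tendsto f atTop l) :
    Tendsto (fun p : ℕ × ℕ => f p.1) atTop l := by
  refine hf.comp ?_
  rw [← prod_atTop_atTop_eq]
  exact tendsto_fst

lemma tendsto_prod_snd {f : ℕ → ℝ} {l : Filter ℝ} (hf : Tendsto f atTop l) :
    Tendsto (fun p : ℕ × ℕ => f p.2) atTop l := by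
  refine hf.comp ?_
  rw [← prod_atTop_atTop_eq]
  exact tendsto_snd

/-- Two sequences converging at infinity are equivalent if `(a_i, b_j)_o → ∞`. -/
def gromovSetoid (h : IsStronglyHyperbolic X ε) (o : X) : Setoid (GromovSeq o) where
  r a b := Tendsto (fun p : ℕ × ℕ => gromovProduct o (a.1 p.1) (b.1 p.2)) atTop atTop
  iseqv :=
    { refl := fun a => a.2
      symm := by
        intro a b hab
        have := tendsto_prodMk_swap_of hab
        simpa only [gromovProduct_comm] using this
      trans := by
        intro a b c hab hbc
        rw [h.tendsto_exp_iff] at hab hbc ⊢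
        have h1 := tendsto_prod_fst (tendsto_atTop_diag hab)
        have h2 : Tendsto (fun p : ℕ × ℕ =>
            Real.exp (-ε * gromovProduct o (b.1 p.1) (c.1 p.2))) atTop (𝓝 0) := hbc
        refine squeeze_zero (fun p => (Real.exp_pos _).le)
          (fun p => h.exp_le (a.1 p.1) (c.1 p.2) (b.1 p.1) o) ?_
        simpa using h1.add h2 }

/-- The Gromov boundary `∂X`: classes of sequences converging at infinity. -/
def GromovBoundary (h : IsStronglyHyperbolic X ε) (o : X) : Type _ :=
  Quotient (gromovSetoid h o)

/-- The boundary point `lim a_n`. -/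
def GromovBoundary.mk (h : IsStronglyHyperbolic X ε) {o : X} (a : GromovSeq o) :
    GromovBoundary h o :=
  Quotient.mk (gromovSetoid h o) a

lemma GromovBoundary.mk_eq_iff (h : IsStronglyHyperbolic X ε) {o : X} (a b : GromovSeq o) :
    GromovBoundary.mk h a = GromovBoundary.mk h b ↔
      Tendsto (fun p : ℕ × ℕ => gromovProduct o (a.1 p.1) (b.1 p.2)) atTop atTop :=
  ⟨fun H => Quotient.exact H, fun H => Quotient.sound (s := gromovSetoid h o) H⟩

lemma GromovBoundary.exists_rep {h : IsStronglyHyperbolic X ε} {o : X}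
    (ξ : GromovBoundary h o) : ∃ a, GromovBoundary.mk h a = ξ :=
  Quotient.exists_rep ξ

namespace GromovBoundary

variable {h : IsStronglyHyperbolic X ε} {o : X}

/-- The Gromov product on the boundary: the supremum of `lim (a_i, b_j)_o` over
all sequences `a`, `b` representing `ξ`, `η`. It lies in `[0, ∞]`. -/
def product (ξ η : GromovBoundary h o) : EReal :=
  ⨆ (a : GromovSeq o) (_ : mk h a = ξ) (b : GromovSeq o) (_ : mk h b = η),
    liminf (fun p : ℕ × ℕ => ((gromovProduct o (a.1 p.1) (b.1 p.2) : ℝ) : EReal)) atTop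

/-- The visual distance `d_{o,ε}(ξ, η) = exp (-ε (ξ, η)_o)`, with `exp (-∞) = 0`. -/
def visualDist (ξ η : GromovBoundary h o) : ℝ :=
  (EReal.exp (-((ε : EReal) * product ξ η))).toReal

lemma exists_tendsto_exp (h : IsStronglyHyperbolic X ε) (a b : GromovSeq o) :
    ∃ L : ℝ, Tendsto (fun p : ℕ × ℕ => Real.exp (-ε * gromovProduct o (a.1 p.1) (b.1 p.2)))
      atTop (𝓝 L) := by
  apply cauchySeq_tendsto_of_complete
  rw [Metric.cauchySeq_iff]
  intro δ hδ
  have ha := (h.tendsto_exp_iff _).1 a.2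
  have hb := (h.tendsto_exp_iff _).1 b.2
  obtain ⟨N, hN⟩ := eventually_atTop.1 (ha.eventually_lt_const (half_pos hδ))
  obtain ⟨M, hM⟩ := eventually_atTop.1 (hb.eventually_lt_const (half_pos hδ))
  refine ⟨(max N.1 N.2, max M.1 M.2), ?_⟩
  intro p hp q hq
  rw [Real.dist_eq]
  have h1 := hN (p.1, q.1) ⟨(le_max_left _ _).trans hp.1, (le_max_right _ _).trans hq.1⟩
  have h2 := hM (p.2, q.2) ⟨(le_max_left _ _).trans hp.2, (le_max_right _ _).trans hq.2⟩
  have := h.abs_exp_sub_le o (a.1 p.1) (a.1 q.1) (b.1 p.2) (b.1 q.2)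
  simp only at h1 h2
  linarith

lemma tendsto_exp_congr (h : IsStronglyHyperbolic X ε) {a a' b b' : GromovSeq o}
    (ha : mk h a = mk h a') (hb : mk h b = mk h b') {L : ℝ}
    (hL : Tendsto (fun p : ℕ × ℕ => Real.exp (-ε * gromovProduct o (a.1 p.1) (b.1 p.2)))
      atTop (𝓝 L)) :
    Tendsto (fun p : ℕ × ℕ => Real.exp (-ε * gromovProduct o (a'.1 p.1) (b'.1 p.2)))
      atTop (𝓝 L) := by
  rw [mk_eq_iff, h.tendsto_exp_iff] at ha hb
  have h1 := tendsto_prod_fst (tendsto_atTop_diag ha)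
  have h2 := tendsto_prod_snd (tendsto_atTop_diag hb)
  have h3 : Tendsto (fun p : ℕ × ℕ => Real.exp (-ε * gromovProduct o (a.1 p.1) (b.1 p.2)) -
      Real.exp (-ε * gromovProduct o (a'.1 p.1) (b'.1 p.2))) atTop (𝓝 0) := by
    refine squeeze_zero_norm (fun p => h.abs_exp_sub_le o _ _ _ _) ?_
    simpa using h1.add h2
  simpa using hL.sub h3

lemma tendsto_coe_of_tendsto_exp (h : IsStronglyHyperbolic X ε) {f : ℕ × ℕ → ℝ} {L : ℝ}
    (hL : Tendsto (fun p => Real.exp (-ε * f p)) atTop (𝓝 L)) :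
    Tendsto (fun p => ((f p : ℝ) : EReal)) atTop
      (𝓝 (if L = 0 then ⊤ else ((-Real.log L / ε : ℝ) : EReal))) := by
  have hε := h.pos
  split_ifs with h0
  · subst h0
    exact EReal.tendsto_coe_nhds_top_iff.2 ((h.tendsto_exp_iff f).2 hL)
  · refine EReal.tendsto_coe.2 ?_
    have := ((hL.log h0).neg).div_const ε
    refine this.congr fun p => ?_
    rw [Real.log_exp]; field_simp

/-- In a strongly hyperbolic space the limits defining the boundary Gromov product exist and do
not depend on the representing sequences. -/
lemma tendsto_visualDist (a b : GromovSeq o) :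
    Tendsto (fun p : ℕ × ℕ => Real.exp (-ε * gromovProduct o (a.1 p.1) (b.1 p.2)))
      atTop (𝓝 (visualDist (mk h a) (mk h b))) := by
  obtain ⟨L, hL⟩ := exists_tendsto_exp h a b
  have hL0 : 0 ≤ L := ge_of_tendsto' hL fun p => (Real.exp_pos _).le
  have key : product (mk h a) (mk h b) =
      (if L = 0 then ⊤ else ((-Real.log L / ε : ℝ) : EReal)) := by
    apply le_antisymm
    · refine iSup₂_le fun a' ha' => iSup₂_le fun b' hb' => ?_
      exact (tendsto_coe_of_tendsto_exp h
        (tendsto_exp_congr h ha'.symm hb'.symm hL)).liminf_eq.le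
    · rw [← (tendsto_coe_of_tendsto_exp h hL).liminf_eq]
      exact le_iSup₂_of_le a rfl (le_iSup₂_of_le b rfl le_rfl)
  have : visualDist (mk h a) (mk h b) = L := by
    unfold visualDist
    rw [key]
    have hε := h.pos
    split_ifs with h0
    · rw [EReal.coe_mul_top_of_pos hε]; simp [h0]
    · rw [← EReal.coe_mul, ← EReal.coe_neg, EReal.exp_coe,
        ENNReal.toReal_ofReal (Real.exp_pos _).le]
      have : -(ε * (-Real.log L / ε)) = Real.log L := by field_simp
      rw [this, Real.exp_log (lt_of_le_of_ne hL0 (Ne.symm h0))]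
  rw [this]; exact hL

/-- The boundary with the visual metric `d_{o,ε}`. -/
instance : MetricSpace (GromovBoundary h o) where
  dist := visualDist
  dist_self ξ := by
    obtain ⟨a, rfl⟩ := exists_rep ξ
    exact tendsto_nhds_unique (tendsto_visualDist a a) ((h.tendsto_exp_iff _).1 a.2)
  dist_comm ξ η := by
    obtain ⟨a, rfl⟩ := exists_rep ξ
    obtain ⟨b, rfl⟩ := exists_rep η
    refine tendsto_nhds_unique (tendsto_visualDist a b) ?_
    simpa only [gromovProduct_comm] using tendsto_prodMk_swap_of (tendsto_visualDist (h := h) b a)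
  dist_triangle ξ η ζ := by
    obtain ⟨a, rfl⟩ := exists_rep ξ
    obtain ⟨b, rfl⟩ := exists_rep η
    obtain ⟨c, rfl⟩ := exists_rep ζ
    exact le_of_tendsto_of_tendsto' (tendsto_atTop_diag (tendsto_visualDist a c))
      ((tendsto_atTop_diag (tendsto_visualDist a b)).add
        (tendsto_atTop_diag (tendsto_visualDist b c))) fun n => h.exp_le _ _ _ _
  eq_of_dist_eq_zero := by
    intro ξ η H
    obtain ⟨a, rfl⟩ := exists_rep ξ
    obtain ⟨b, rfl⟩ := exists_rep η
    rw [mk_eq_iff, h.tendsto_exp_iff]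
    have := tendsto_visualDist (h := h) a b
    rwa [show visualDist (mk h a) (mk h b) = 0 from H] at this

instance : MeasurableSpace (GromovBoundary h o) := borel _

instance : BorelSpace (GromovBoundary h o) := ⟨rfl⟩

end GromovBoundary

end Boundary

/-! ### The action on the boundary, limit set and volume growth -/

section Action

variable {X : Type*} [MetricSpace X] {ε : ℝ} {Γ : Type*} [Group Γ] [MulAction Γ X]

/-- The translate `(γ a_n)` of a sequence converging at infinity. -/
def GromovSeq.translate [IsIsometricSMul Γ X] {o : X} (γ : Γ) (a : GromovSeq o) : GromovSeq o :=
  ⟨fun n => γ • a.1 n, by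
    refine tendsto_atTop_mono (fun p => gromovProduct_smul_ge γ o _ _) ?_
    simpa only [sub_eq_add_neg] using tendsto_atTop_add_const_right _ _ a.2⟩

/-- The action of `Γ` on `∂X`: `γ • lim a_n = lim (γ • a_n)`. -/
instance [IsIsometricSMul Γ X] {h : IsStronglyHyperbolic X ε} {o : X} :
    MulAction Γ (GromovBoundary h o) where
  smul γ := Quotient.map (GromovSeq.translate γ) (by
    intro a b hab
    change Tendsto (fun p : ℕ × ℕ => gromovProduct o (γ • a.1 p.1) (γ • b.1 p.2)) atTop atTop
    refine tendsto_atTop_mono (fun p => gromovProduct_smul_ge γ o _ _) ?_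
    simpa only [sub_eq_add_neg] using tendsto_atTop_add_const_right _ _ hab)
  one_smul ξ := by
    obtain ⟨a, rfl⟩ := ξ.exists_rep
    exact congrArg (GromovBoundary.mk h) (Subtype.ext (funext fun n => one_smul Γ (a.1 n)))
  mul_smul γ γ' ξ := by
    obtain ⟨a, rfl⟩ := ξ.exists_rep
    exact congrArg (GromovBoundary.mk h) (Subtype.ext (funext fun n => mul_smul γ γ' (a.1 n)))

lemma GromovBoundary.smul_mk [IsIsometricSMul Γ X] {h : IsStronglyHyperbolic X ε} {o : X}
    (γ : Γ) (a : GromovSeq o) :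
    γ • GromovBoundary.mk h a = GromovBoundary.mk h (a.translate γ) := rfl

variable (Γ)

/-- The limit set of `Γ`: the boundary points that are limits of sequences in the orbit `Γ o`. -/
def limitSet (h : IsStronglyHyperbolic X ε) (o : X) : Set (GromovBoundary h o) :=
  {ξ | ∃ a : GromovSeq o, (∀ n, a.1 n ∈ MulAction.orbit Γ o) ∧ GromovBoundary.mk h a = ξ}

/-- `Γ` is nonelementary: its limit set has more than two points. -/
def IsNonelementary (h : IsStronglyHyperbolic X ε) (o : X) : Prop :=
  2 < (limitSet Γ h o).encard

/-- The volume growth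
`α = limsup_{R → ∞} (1 / R) log |Γ o ∩ B(o, R)|`, with `B(o, R)` the closed ball. -/
def volumeGrowth (o : X) : ℝ :=
  limsup (fun R : ℝ => 1 / R *
    Real.log ((MulAction.orbit Γ o ∩ Metric.closedBall o R).ncard : ℝ)) atTop

/-- The Patterson-Sullivan measure `ν_o`: the Hausdorff measure of dimension `α / ε` of the
boundary with its visual metric `d_{o,ε}`, normalized to total mass one. -/
def pattersonSullivan (h : IsStronglyHyperbolic X ε) (o : X) : Measure (GromovBoundary h o) :=
  (μH[volumeGrowth Γ o / ε] (Set.univ : Set (GromovBoundary h o)))⁻¹ • μH[volumeGrowth Γ o / ε]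

/-- The length function `|γ| = d(o, γ o)`. -/
def orbitLength {Γ : Type*} [Group Γ] [MulAction Γ X] (o : X) (γ : Γ) : ℝ := dist o (γ • o)

end Action

/-! ### Representations -/

/-- `π` is the quasi-regular representation `π_s` of `Γ` on `L²(B, ν)`:
`(π_s(γ) v)(b) = (dγ_*ν / dν)(b) ^ s * v (γ⁻¹ b)` for almost every `b`. -/
def IsQuasiRegularRep {Γ B : Type*} [Group Γ] [MulAction Γ B] [MeasurableSpace B]
    (ν : Measure B) (s : ℝ) (π : Γ →* (Lp ℂ 2 ν →L[ℂ] Lp ℂ 2 ν)) : Prop :=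
  ∀ (γ : Γ) (v : Lp ℂ 2 ν), (π γ v : B → ℂ) =ᵐ[ν] fun b =>
    (((((ν.map (fun x => γ • x)).rnDeriv ν b).toReal ^ s : ℝ) : ℂ)) * v (γ⁻¹ • b)

/-- `π` is a slow growth representation, of `ε`-exponential type with `ε > 0`, with respect to
the length function `len`. -/
def IsExponentialType {Γ H : Type*} [Group Γ] [NormedAddCommGroup H] [NormedSpace ℂ H]
    (len : Γ → ℝ) (ε : ℝ) (π : Γ →* (H →L[ℂ] H)) : Prop :=
  0 < ε ∧ ∃ C : ℝ, 0 < C ∧ ∀ γ : Γ, ‖π γ‖ ≤ C * Real.exp (ε * len γ)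

end

/-! ### Quasi-regular representations with bounded densities -/

section QuasiRegular

variable {Γ B : Type*} [Group Γ] [MulAction Γ B] [MeasurableSpace B] [MeasurableConstSMul Γ B]
  {ν : Measure B} [IsFiniteMeasure ν]

/-! Write `ν` for the Patterson–Sullivan measure and `α` for the volume growth. Translation by `γ`
lowers Gromov products at `o` by at most `|γ|`, so it is `exp (ε|γ|)`-Lipschitz for the visual
metric and distorts Hausdorff measure of dimension `α/ε` by at most `exp (α|γ|)`
(`pattersonSullivan_map_smul_le`). With the cocycle identity, applied to `γ` and `γ⁻¹`, this puts
the density of `γ_*ν` between `exp (-α|γ|)` and `exp (α|γ|)`. Now `π_{1/2}` is isometric and `π_s`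
differs from it by the density to the power `s - 1/2`, so the norm bound holds with `C = 1`
(`exists_quasiRegularRep`).

What remains is `α > 0`. Three distinct limit points give three group elements that move `o`
arbitrarily far in directions with uniformly bounded Gromov products. Seen from any orbit point, at
least two of the three lead away from `o`; iterating gives a binary tree whose `2 ^ n` vertices at
level `n` are distinct orbit points at distance at most `n * T` (`exists_finset_orbit_card_ge`).
Since the limsup is taken in `ℝ`, an exponential upper bound on orbit counts is also needed; it
comes from rough geodesics and cocompactness (`isBoundedUnder_log_ncard_orbit`). -/

omit [IsFiniteMeasure ν] in
lemma quasiMeasurePreserving_smul (hac : ∀ γ : Γ, ν.map (fun x => γ • x) ≪ ν) (γ : Γ) :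
    Measure.QuasiMeasurePreserving (fun x => γ • x) ν ν :=
  ⟨measurable_const_smul γ, hac γ⟩

omit [MeasurableConstSMul Γ B] in
lemma rnDeriv_map_one : (ν.map (fun x => (1 : Γ) • x)).rnDeriv ν =ᵐ[ν] fun _ => 1 := by
  have : ν.map (fun x => (1 : Γ) • x) = ν := by simp
  rw [this]
  exact ν.rnDeriv_self

/-- Cocycle identity: both sides have the same integral over every measurable set, by the change of
variables `b ↦ γ • b`. It makes `π_s` multiplicative. -/
lemma rnDeriv_map_mul (hac : ∀ γ : Γ, ν.map (fun x => γ • x) ≪ ν) (γ δ : Γ) :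
    (ν.map (fun x => (γ * δ) • x)).rnDeriv ν =ᵐ[ν] fun b =>
      (ν.map (fun x => γ • x)).rnDeriv ν b * (ν.map (fun x => δ • x)).rnDeriv ν (γ⁻¹ • b) := by
  have hm : ∀ γ : Γ, Measurable fun x : B => γ • x := fun γ => measurable_const_smul γ
  have hδ : Measurable fun b => (ν.map (fun x => δ • x)).rnDeriv ν (γ⁻¹ • b) :=
    (Measure.measurable_rnDeriv _ _).comp (hm _)
  refine (withDensity_eq_iff_of_sigmaFinite (Measure.measurable_rnDeriv _ _).aemeasurable
    ((Measure.measurable_rnDeriv _ _).mul hδ).aemeasurable).1 ?_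
  rw [Measure.withDensity_rnDeriv_eq _ _ (hac _)]
  ext A hA
  rw [withDensity_apply _ hA, ← lintegral_indicator hA]
  have h1 : (fun b => A.indicator ((ν.map (fun x => γ • x)).rnDeriv ν *
      fun b => (ν.map (fun x => δ • x)).rnDeriv ν (γ⁻¹ • b)) b) = fun b =>
      (ν.map (fun x => γ • x)).rnDeriv ν b *
        A.indicator (fun b => (ν.map (fun x => δ • x)).rnDeriv ν (γ⁻¹ • b)) b := by
    ext b; by_cases hb : b ∈ A <;> simp [hb]
  rw [h1, lintegral_rnDeriv_mul (hac γ) (hδ.indicator hA).aemeasurable,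
    lintegral_map (hδ.indicator hA) (hm γ)]
  have h2 : (fun b => A.indicator (fun b => (ν.map (fun x => δ • x)).rnDeriv ν (γ⁻¹ • b))
      (γ • b)) = ((fun x => γ • x) ⁻¹' A).indicator ((ν.map (fun x => δ • x)).rnDeriv ν) := by
    ext b; by_cases hb : γ • b ∈ A <;> simp [hb]
  rw [h2, lintegral_indicator (hm γ hA), Measure.setLIntegral_rnDeriv (hac δ),
    Measure.map_apply (hm _) hA, Measure.map_apply (hm _) (hm γ hA)]
  congr 1
  ext b; simp [mul_smul]

lemma rnDeriv_le_of_le_smul {μ : Measure B} {c : ℝ≥0∞} (hμ : μ ≤ c • ν) :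
    ∀ᵐ b ∂ν, μ.rnDeriv ν b ≤ c := by
  refine ae_le_of_forall_setLIntegral_le_of_sigmaFinite (Measure.measurable_rnDeriv _ _)
    fun A _ _ => ?_
  calc ∫⁻ b in A, μ.rnDeriv ν b ∂ν ≤ μ A := Measure.setLIntegral_rnDeriv_le A
    _ ≤ (c • ν) A := hμ A
    _ = ∫⁻ _ in A, c ∂ν := by simp

variable {len : Γ → ℝ}

/-- The lower bound comes from the cocycle identity for `γ * γ⁻¹ = 1`: the density of `γ` at `b`
times that of `γ⁻¹` at `γ⁻¹ • b` is `1`, and the second factor is bounded above. -/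
lemma abs_log_rnDeriv_map_le
    (hν : ∀ γ : Γ, ν.map (fun x => γ • x) ≤ ENNReal.ofReal (Real.exp (len γ)) • ν)
    (hinv : ∀ γ : Γ, len γ⁻¹ = len γ) (γ : Γ) :
    ∀ᵐ b ∂ν, 0 < ((ν.map (fun x => γ • x)).rnDeriv ν b).toReal ∧
      |Real.log ((ν.map (fun x => γ • x)).rnDeriv ν b).toReal| ≤ len γ := by
  have hac : ∀ γ : Γ, ν.map (fun x => γ • x) ≪ ν := fun γ =>
    Measure.absolutelyContinuous_of_le_smul (hν γ)
  have h1 := rnDeriv_map_mul hac γ γ⁻¹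
  have h2 : ∀ᵐ b ∂ν, (ν.map (fun x => γ⁻¹ • x)).rnDeriv ν (γ⁻¹ • b) ≤
      ENNReal.ofReal (Real.exp (len γ⁻¹)) :=
    (quasiMeasurePreserving_smul hac γ⁻¹).ae (rnDeriv_le_of_le_smul (hν γ⁻¹))
  have h3 : (ν.map (fun x => (γ * γ⁻¹) • x)).rnDeriv ν =ᵐ[ν] fun _ => 1 := by
    rw [mul_inv_cancel]; exact rnDeriv_map_one
  filter_upwards [h1, h2, h3, rnDeriv_le_of_le_smul (hν γ)] with b h1 h2 h3 h4
  rw [h3] at h1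
  rw [hinv] at h2
  have h5 := congrArg ENNReal.toReal h1
  rw [ENNReal.toReal_mul, ENNReal.toReal_one] at h5
  have h6 := ENNReal.toReal_le_of_le_ofReal (Real.exp_pos _).le h2
  have h7 := ENNReal.toReal_le_of_le_ofReal (Real.exp_pos _).le h4
  set r := ((ν.map (fun x => γ • x)).rnDeriv ν b).toReal
  have hr : 0 < r := by
    refine lt_of_le_of_ne ENNReal.toReal_nonneg fun h => ?_
    rw [← h] at h5; simp at h5
  refine ⟨hr, abs_le.2 ⟨?_, (Real.log_le_iff_le_exp hr).2 h7⟩⟩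
  rw [Real.le_log_iff_exp_le hr, Real.exp_neg, inv_le_iff_one_le_mul₀ (Real.exp_pos _), h5]
  exact mul_le_mul_of_nonneg_left h6 hr.le

/-- At exponent `1/2` the squared factor is the density itself, which turns `ν` into `γ_*ν` and
undoes the translation. -/
lemma eLpNorm_sqrt_rnDeriv_mul (hac : ∀ γ : Γ, ν.map (fun x => γ • x) ≪ ν) (γ : Γ) {v : B → ℂ}
    (hv : AEStronglyMeasurable v ν) :
    eLpNorm (fun b => ((((ν.map (fun x => γ • x)).rnDeriv ν b).toReal ^ (1 / 2 : ℝ) : ℝ) : ℂ) *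
      v (γ⁻¹ • b)) 2 ν = eLpNorm v 2 ν := by
  rw [eLpNorm_eq_lintegral_rpow_enorm_toReal two_ne_zero ENNReal.ofNat_ne_top,
    eLpNorm_eq_lintegral_rpow_enorm_toReal two_ne_zero ENNReal.ofNat_ne_top]
  congr 1
  have hv1 : AEMeasurable (fun b => ‖v (γ⁻¹ • b)‖ₑ ^ (2 : ℝ≥0∞).toReal) ν :=
    ((hv.comp_quasiMeasurePreserving (quasiMeasurePreserving_smul hac γ⁻¹)).enorm).pow_const _
  have h1 : ∀ᵐ b ∂ν, ‖((((ν.map (fun x => γ • x)).rnDeriv ν b).toReal ^ (1 / 2 : ℝ) : ℝ) : ℂ) *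
      v (γ⁻¹ • b)‖ₑ ^ (2 : ℝ≥0∞).toReal =
      (ν.map (fun x => γ • x)).rnDeriv ν b * ‖v (γ⁻¹ • b)‖ₑ ^ (2 : ℝ≥0∞).toReal := by
    filter_upwards [Measure.rnDeriv_lt_top (ν.map (fun x => γ • x)) ν] with b hb
    rw [enorm_mul, ENNReal.mul_rpow_of_nonneg _ _ ENNReal.toReal_nonneg]
    congr 1
    rw [← ofReal_norm, Complex.norm_real, Real.norm_of_nonneg (by positivity),
      ENNReal.ofReal_rpow_of_nonneg (by positivity) (by simp), ← Real.rpow_mul (by positivity)]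
    simp [ENNReal.ofReal_toReal hb.ne]
  rw [lintegral_congr_ae h1, lintegral_rnDeriv_mul (hac γ) hv1]
  refine (lintegral_map_equiv _ (MeasurableEquiv.smul γ)).trans ?_
  simp

/-- Compare pointwise with the isometric case `s = 1/2`: the ratio is the density to the power `s -
1/2`. -/
lemma eLpNorm_rnDeriv_rpow_mul_le
    (hν : ∀ γ : Γ, ν.map (fun x => γ • x) ≤ ENNReal.ofReal (Real.exp (len γ)) • ν)
    (hinv : ∀ γ : Γ, len γ⁻¹ = len γ) (s : ℝ) (γ : Γ) {v : B → ℂ}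
    (hv : AEStronglyMeasurable v ν) :
    eLpNorm (fun b => ((((ν.map (fun x => γ • x)).rnDeriv ν b).toReal ^ s : ℝ) : ℂ) *
      v (γ⁻¹ • b)) 2 ν ≤ ENNReal.ofReal (Real.exp (|1 / 2 - s| * len γ)) * eLpNorm v 2 ν := by
  rw [← eLpNorm_sqrt_rnDeriv_mul
    (fun γ => Measure.absolutelyContinuous_of_le_smul (hν γ)) γ hv]
  refine eLpNorm_le_mul_eLpNorm_of_ae_le_mul ?_ 2
  filter_upwards [abs_log_rnDeriv_map_le hν hinv γ] with b ⟨hr, hb⟩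
  set r := ((ν.map (fun x => γ • x)).rnDeriv ν b).toReal
  rw [norm_mul, norm_mul, ← mul_assoc]
  refine mul_le_mul_of_nonneg_right ?_ (norm_nonneg _)
  rw [Complex.norm_real, Complex.norm_real, Real.norm_of_nonneg (by positivity),
    Real.norm_of_nonneg (by positivity), Real.rpow_def_of_pos hr, Real.rpow_def_of_pos hr,
    ← Real.exp_add, Real.exp_le_exp]
  have : Real.log r * (s - 1 / 2) ≤ |1 / 2 - s| * len γ := by
    calc _ ≤ |Real.log r * (s - 1 / 2)| := le_abs_self _
      _ = |1 / 2 - s| * |Real.log r| := by rw [abs_mul, abs_sub_comm s, mul_comm]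
      _ ≤ _ := mul_le_mul_of_nonneg_left hb (abs_nonneg _)
  linarith

lemma memLp_rnDeriv_rpow_mul
    (hν : ∀ γ : Γ, ν.map (fun x => γ • x) ≤ ENNReal.ofReal (Real.exp (len γ)) • ν)
    (hinv : ∀ γ : Γ, len γ⁻¹ = len γ) (s : ℝ) (γ : Γ) {v : B → ℂ} (hv : MemLp v 2 ν) :
    MemLp (fun b => ((((ν.map (fun x => γ • x)).rnDeriv ν b).toReal ^ s : ℝ) : ℂ) *
      v (γ⁻¹ • b)) 2 ν := by
  refine ⟨AEStronglyMeasurable.mul ?_ ?_, ?_⟩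
  · exact (Complex.measurable_ofReal.comp
      ((Measure.measurable_rnDeriv _ _).ennreal_toReal.pow_const s)).aestronglyMeasurable
  · exact hv.1.comp_quasiMeasurePreserving (quasiMeasurePreserving_smul
      (fun γ => Measure.absolutelyContinuous_of_le_smul (hν γ)) γ⁻¹)
  · exact (eLpNorm_rnDeriv_rpow_mul_le hν hinv s γ hv.1).trans_lt
      (ENNReal.mul_lt_top ENNReal.ofReal_lt_top hv.2)

/-- The operator `v ↦ (dγ_*ν / dν) ^ s * v ∘ γ⁻¹` on `L²`. -/
noncomputable def quasiRegularOp
    (hν : ∀ γ : Γ, ν.map (fun x => γ • x) ≤ ENNReal.ofReal (Real.exp (len γ)) • ν)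
    (hinv : ∀ γ : Γ, len γ⁻¹ = len γ) (s : ℝ) (γ : Γ) : Lp ℂ 2 ν →L[ℂ] Lp ℂ 2 ν :=
  LinearMap.mkContinuous
    { toFun := fun v => (memLp_rnDeriv_rpow_mul hν hinv s γ (Lp.memLp v)).toLp _
      map_add' := by
        intro v w
        have hq := quasiMeasurePreserving_smul
          (fun γ => Measure.absolutelyContinuous_of_le_smul (hν γ)) γ⁻¹
        rw [← MemLp.toLp_add, MemLp.toLp_eq_toLp_iff]
        filter_upwards [hq.ae (Lp.coeFn_add v w)] with b hb
        simp only [hb, Pi.add_apply, mul_add]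
      map_smul' := by
        intro c v
        have hq := quasiMeasurePreserving_smul
          (fun γ => Measure.absolutelyContinuous_of_le_smul (hν γ)) γ⁻¹
        rw [RingHom.id_apply, ← MemLp.toLp_const_smul, MemLp.toLp_eq_toLp_iff]
        filter_upwards [hq.ae (Lp.coeFn_smul c v)] with b hb
        simp only [hb, Pi.smul_apply, smul_eq_mul]
        ring }
    (Real.exp (|1 / 2 - s| * len γ)) (by
      intro v
      change ‖(memLp_rnDeriv_rpow_mul hν hinv s γ (Lp.memLp v)).toLp _‖ ≤ _
      rw [Lp.norm_toLp, Lp.norm_def,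
        ← ENNReal.toReal_ofReal (Real.exp_pos (|1 / 2 - s| * len γ)).le, ← ENNReal.toReal_mul]
      exact ENNReal.toReal_mono (ENNReal.mul_ne_top ENNReal.ofReal_ne_top (Lp.memLp v).2.ne)
        (eLpNorm_rnDeriv_rpow_mul_le hν hinv s γ (Lp.memLp v).1))

lemma coeFn_quasiRegularOp
    (hν : ∀ γ : Γ, ν.map (fun x => γ • x) ≤ ENNReal.ofReal (Real.exp (len γ)) • ν)
    (hinv : ∀ γ : Γ, len γ⁻¹ = len γ) (s : ℝ) (γ : Γ) (v : Lp ℂ 2 ν) :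
    quasiRegularOp hν hinv s γ v =ᵐ[ν] fun b =>
      ((((ν.map (fun x => γ • x)).rnDeriv ν b).toReal ^ s : ℝ) : ℂ) * v (γ⁻¹ • b) :=
  MemLp.coeFn_toLp (memLp_rnDeriv_rpow_mul hν hinv s γ (Lp.memLp v))

lemma norm_quasiRegularOp_le
    (hν : ∀ γ : Γ, ν.map (fun x => γ • x) ≤ ENNReal.ofReal (Real.exp (len γ)) • ν)
    (hinv : ∀ γ : Γ, len γ⁻¹ = len γ) (s : ℝ) (γ : Γ) :
    ‖quasiRegularOp hν hinv s γ‖ ≤ Real.exp (|1 / 2 - s| * len γ) := by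
  unfold quasiRegularOp
  exact LinearMap.mkContinuous_norm_le _ (Real.exp_pos _).le _

/-- If the density of `γ_*ν` is at most `exp (len γ)`, the quasi-regular representation exists
and `‖π_s(γ)‖ ≤ exp (|1/2 - s| len γ)`. -/
theorem exists_quasiRegularRep
    (hν : ∀ γ : Γ, ν.map (fun x => γ • x) ≤ ENNReal.ofReal (Real.exp (len γ)) • ν)
    (hinv : ∀ γ : Γ, len γ⁻¹ = len γ) (s : ℝ) :
    ∃ π : Γ →* (Lp ℂ 2 ν →L[ℂ] Lp ℂ 2 ν), IsQuasiRegularRep ν s π ∧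
      ∀ γ, ‖π γ‖ ≤ Real.exp (|1 / 2 - s| * len γ) := by
  have hac : ∀ γ : Γ, ν.map (fun x => γ • x) ≪ ν := fun γ =>
    Measure.absolutelyContinuous_of_le_smul (hν γ)
  refine ⟨{ toFun := quasiRegularOp hν hinv s, map_one' := ?_, map_mul' := ?_ },
    fun γ v => coeFn_quasiRegularOp hν hinv s γ v,
    fun γ => norm_quasiRegularOp_le hν hinv s γ⟩
  · ext1 v
    refine Lp.ext ?_
    filter_upwards [coeFn_quasiRegularOp hν hinv s 1 v, rnDeriv_map_one (Γ := Γ) (ν := ν)]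
      with b h1 h2
    rw [h1, h2]
    simp
  · intro γ δ
    ext1 v
    refine Lp.ext ?_
    filter_upwards [coeFn_quasiRegularOp hν hinv s (γ * δ) v,
      coeFn_quasiRegularOp hν hinv s γ (quasiRegularOp hν hinv s δ v),
      (quasiMeasurePreserving_smul hac γ⁻¹).ae (coeFn_quasiRegularOp hν hinv s δ v),
      rnDeriv_map_mul hac γ δ] with b h1 h2 h3 h4
    rw [h1, mul_apply_eq_comp, h2, h3, h4, ENNReal.toReal_mul,
      Real.mul_rpow ENNReal.toReal_nonneg ENNReal.toReal_nonneg, mul_inv_rev, mul_smul]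
    push_cast
    ring

end QuasiRegular

/-! ### The Patterson-Sullivan measure is quasi-invariant -/

section BoundaryAction

variable {X : Type*} [MetricSpace X] {ε : ℝ} {Γ : Type*} [Group Γ] [MulAction Γ X]

lemma orbitLength_inv [IsIsometricSMul Γ X] (o : X) (γ : Γ) :
    orbitLength o γ⁻¹ = orbitLength o γ := by
  unfold orbitLength
  rw [← dist_smul γ o (γ⁻¹ • o), smul_inv_smul, dist_comm]

namespace GromovBoundary

variable [IsIsometricSMul Γ X] {h : IsStronglyHyperbolic X ε} {o : X}

lemma dist_smul_le (γ : Γ) (ξ η : GromovBoundary h o) :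
    dist (γ • ξ) (γ • η) ≤ Real.exp (ε * orbitLength o γ) * dist ξ η := by
  obtain ⟨a, rfl⟩ := ξ.exists_rep
  obtain ⟨b, rfl⟩ := η.exists_rep
  rw [smul_mk, smul_mk]
  refine le_of_tendsto_of_tendsto' (tendsto_visualDist (h := h) (a.translate γ) (b.translate γ))
    ((tendsto_visualDist (h := h) a b).const_mul _) fun p => ?_
  rw [← Real.exp_add, Real.exp_le_exp]
  have h1 := gromovProduct_smul_ge γ o (a.1 p.1) (b.1 p.2)
  have h2 := mul_le_mul_of_nonneg_left h1 h.pos.le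
  have h3 : orbitLength o γ = dist (γ • o) o := dist_comm _ _
  rw [h3]
  change -ε * gromovProduct o (γ • a.1 p.1) (γ • b.1 p.2) ≤ _
  linarith

lemma lipschitzWith_smul (γ : Γ) :
    LipschitzWith (Real.exp (ε * orbitLength o γ)).toNNReal
      (fun ξ : GromovBoundary h o => γ • ξ) :=
  LipschitzWith.of_dist_le_mul fun ξ η => by
    rw [Real.coe_toNNReal _ (Real.exp_pos _).le]
    exact dist_smul_le γ ξ η

instance : MeasurableConstSMul Γ (GromovBoundary h o) where
  measurable_const_smul γ := (lipschitzWith_smul γ).continuous.measurable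

/-- A preimage under `γ` is an image under `γ⁻¹`, whose Lipschitz constant `exp (ε|γ|)` enters to
the power `d`. For `d = α/ε` the exponent becomes `α|γ|`. -/
lemma hausdorffMeasure_map_smul_le {d : ℝ} (hd : 0 ≤ d) (γ : Γ) :
    (μH[d] : Measure (GromovBoundary h o)).map (fun ξ => γ • ξ) ≤
      ENNReal.ofReal (Real.exp (ε * d * orbitLength o γ)) • μH[d] := by
  refine Measure.le_iff.2 fun A hA => ?_
  rw [Measure.map_apply (measurable_const_smul γ) hA]
  have h1 : (fun ξ : GromovBoundary h o => γ • ξ) ⁻¹' A = (fun ξ => γ⁻¹ • ξ) '' A :=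
    Set.preimage_smul γ A
  rw [h1]
  refine ((lipschitzWith_smul γ⁻¹).hausdorffMeasure_image_le hd A).trans_eq ?_
  rw [orbitLength_inv, Measure.smul_apply, smul_eq_mul]
  congr 1
  change ENNReal.ofReal _ ^ d = _
  rw [ENNReal.ofReal_rpow_of_pos (Real.exp_pos _), ← Real.exp_mul]
  congr 2
  ring

end GromovBoundary

variable (h : IsStronglyHyperbolic X ε) (o : X)

instance : IsFiniteMeasure (pattersonSullivan Γ h o) where
  measure_univ_lt_top := by
    unfold pattersonSullivan
    rw [Measure.smul_apply, smul_eq_mul]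
    -- This also covers Hausdorff measure of total mass `0` or `∞`, where the normalized measure is
    -- zero.
    exact (ENNReal.inv_mul_le_one _).trans_lt ENNReal.one_lt_top

lemma pattersonSullivan_map_smul_le [IsIsometricSMul Γ X] (hα : 0 ≤ volumeGrowth Γ o) (γ : Γ) :
    (pattersonSullivan Γ h o).map (fun ξ => γ • ξ) ≤
      ENNReal.ofReal (Real.exp (volumeGrowth Γ o * orbitLength o γ)) •
        pattersonSullivan Γ h o := by
  have h1 := GromovBoundary.hausdorffMeasure_map_smul_le (h := h) (o := o)
    (div_nonneg hα h.pos.le) γ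
  rw [mul_div_cancel₀ _ h.pos.ne'] at h1
  unfold pattersonSullivan
  rw [Measure.map_smul, smul_comm]
  gcongr

end BoundaryAction

/-! ### The volume growth is positive and finite -/

section Growth

variable {X : Type*} [MetricSpace X] {ε : ℝ} {Γ : Type*} [Group Γ] [MulAction Γ X]

lemma orbit_inter_closedBall_finite [ProperSpace X] [ProperlyDiscontinuousSMul Γ X]
    (o : X) (R : ℝ) : (MulAction.orbit Γ o ∩ Metric.closedBall o R).Finite := by
  have h := ProperlyDiscontinuousSMul.finite_disjoint_inter_image (Γ := Γ)
    (isCompact_singleton (x := o)) (isCompact_closedBall o R)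
  refine (h.image fun γ => γ • o).subset ?_
  rintro _ ⟨⟨γ, rfl⟩, hγ⟩
  exact ⟨γ, ⟨γ • o, ⟨o, rfl, rfl⟩, hγ⟩, rfl⟩

lemma one_le_ncard_orbit_inter_closedBall [ProperSpace X] [ProperlyDiscontinuousSMul Γ X]
    (o : X) {R : ℝ} (hR : 0 ≤ R) :
    1 ≤ (MulAction.orbit Γ o ∩ Metric.closedBall o R).ncard :=
  (Set.ncard_pos (orbit_inter_closedBall_finite o R)).2
    ⟨o, MulAction.mem_orbit_self o, Metric.mem_closedBall_self hR⟩

lemma ncard_orbit_inter_closedBall_mono [ProperSpace X] [ProperlyDiscontinuousSMul Γ X]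
    (o : X) {R S : ℝ} (hRS : R ≤ S) :
    (MulAction.orbit Γ o ∩ Metric.closedBall o R).ncard ≤
      (MulAction.orbit Γ o ∩ Metric.closedBall o S).ncard :=
  Set.ncard_le_ncard (Set.inter_subset_inter_right _ (Metric.closedBall_subset_closedBall hRS))
    (orbit_inter_closedBall_finite o S)

/-- The balls around `o` of integer radius project to an increasing open cover of the compact
quotient, so a single ball already surjects. -/
lemma exists_dist_orbit_le [IsIsometricSMul Γ X]
    [CompactSpace (Quotient (MulAction.orbitRel Γ X))] (o : X) :
    ∃ D : ℝ, 0 ≤ D ∧ ∀ x : X, ∃ γ : Γ, dist x (γ • o) ≤ D := by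
  let π : X → Quotient (MulAction.orbitRel Γ X) := Quotient.mk _
  have hopen : IsOpenMap π := isOpenMap_quotient_mk'_mul
  obtain ⟨n, hn⟩ := (isCompact_univ (X := Quotient (MulAction.orbitRel Γ X))).elim_directed_cover
    (fun n : ℕ => π '' Metric.ball o n) (fun n => hopen _ Metric.isOpen_ball)
    (by
      intro q _
      obtain ⟨x, rfl⟩ := Quotient.exists_rep q
      obtain ⟨n, hn⟩ := exists_nat_gt (dist x o)
      exact Set.mem_iUnion.2 ⟨n, x, hn, rfl⟩)
    (directed_of_isDirected_le fun m n hmn =>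
      Set.image_mono (Metric.ball_subset_ball (Nat.cast_le.2 hmn)))
  refine ⟨n, n.cast_nonneg, fun x => ?_⟩
  obtain ⟨y, hy, hxy⟩ := hn (Set.mem_univ (π x))
  obtain ⟨γ, hγ⟩ : y ∈ MulAction.orbit Γ x := MulAction.orbitRel_apply.1 (Quotient.exact hxy)
  refine ⟨γ⁻¹, ?_⟩
  rw [← dist_smul γ x, smul_inv_smul]
  change dist ((fun g : Γ => g • x) γ) o ≤ n
  rw [hγ]
  exact (Metric.mem_ball.1 hy).le

lemma exists_orbit_dist_le_of_dist_le_add_one [IsIsometricSMul Γ X]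
    [CompactSpace (Quotient (MulAction.orbitRel Γ X))] (hgeo : IsRoughlyGeodesic X) (o : X) :
    ∃ S : ℝ, ∀ R : ℝ, 0 ≤ R → ∀ x : X, dist x o ≤ R + 1 →
      ∃ γ : Γ, dist (γ • o) o ≤ R ∧ dist x (γ • o) ≤ S := by
  obtain ⟨D, hD, hcov⟩ := exists_dist_orbit_le (Γ := Γ) o
  obtain ⟨C, hC, hr⟩ := hgeo
  -- Go back from `x` towards `o` by parameter length `2 * C + 1 + D`: this absorbs two
  -- rough-geodesic errors, the excess `1` over `R`, and the distance `D` to a nearby orbit point.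
  -- If the path is too short for this, `o` itself is close enough to `x`.
  refine ⟨(2 * C + 1 + D) + C + D, fun R hR x hx => ?_⟩
  obtain ⟨a, b, r, hab, ha, hb, hr⟩ := hr o x
  have hmem_a : a ∈ Set.Icc a b := ⟨le_rfl, hab⟩
  have hmem_b : b ∈ Set.Icc a b := ⟨hab, le_rfl⟩
  have h1 := hr b hmem_b a hmem_a
  rw [ha, hb, abs_of_nonneg (sub_nonneg.2 hab)] at h1
  by_cases hs : b - a ≤ 2 * C + 1 + D
  · exact ⟨1, by simpa using hR, by rw [one_smul]; linarith [h1.2]⟩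
  · have hmem : b - (2 * C + 1 + D) ∈ Set.Icc a b := ⟨by linarith, by linarith⟩
    have h2 := (hr _ hmem a hmem_a).2
    have h3 := (hr b hmem_b _ hmem).2
    rw [ha, abs_of_nonneg (by linarith)] at h2
    rw [hb, abs_of_nonneg (by linarith)] at h3
    obtain ⟨γ, hγ⟩ := hcov (r (b - (2 * C + 1 + D)))
    refine ⟨γ, ?_, ?_⟩
    · have := dist_triangle (γ • o) (r (b - (2 * C + 1 + D))) o
      rw [dist_comm (γ • o) (r _)] at this
      linarith [h1.1]
    · have := dist_triangle x (r (b - (2 * C + 1 + D))) (γ • o)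
      linarith

/-! ### Upper bound: orbit counts grow at most exponentially. -/

section Upper

variable [ProperSpace X] [IsIsometricSMul Γ X] [ProperlyDiscontinuousSMul Γ X]
  [CompactSpace (Quotient (MulAction.orbitRel Γ X))]

variable (Γ) in
lemma exists_ncard_orbit_closedBall_add_one_le (hgeo : IsRoughlyGeodesic X) (o : X) :
    ∃ Q : ℕ, ∀ R : ℝ, 0 ≤ R → (MulAction.orbit Γ o ∩ Metric.closedBall o (R + 1)).ncard ≤
      (MulAction.orbit Γ o ∩ Metric.closedBall o R).ncard * Q := by
  obtain ⟨S, hS⟩ := exists_orbit_dist_le_of_dist_le_add_one (Γ := Γ) hgeo o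
  refine ⟨(MulAction.orbit Γ o ∩ Metric.closedBall o S).ncard, fun R hR => ?_⟩
  -- Stabilizers may be nontrivial, so a section `g` of the orbit map is fixed: `x` is then
  -- recovered from the pair `(z, (g z)⁻¹ • x)`, where `z` is an orbit point in the smaller ball
  -- near `x`.
  have hsec : ∀ z : X, ∃ γ : Γ, z ∈ MulAction.orbit Γ o → γ • o = z := fun z => by
    by_cases hz : z ∈ MulAction.orbit Γ o
    · obtain ⟨γ, hγ⟩ := hz
      exact ⟨γ, fun _ => hγ⟩
    · exact ⟨1, fun h => absurd h hz⟩
  choose g hg using hsec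
  rw [← Set.ncard_prod]
  have hfin := (orbit_inter_closedBall_finite (Γ := Γ) o R).prod
    (orbit_inter_closedBall_finite (Γ := Γ) o S)
  refine le_trans (Set.ncard_le_ncard ?_ (hfin.image fun p => g p.1 • p.2))
    (Set.ncard_image_le hfin)
  rintro x ⟨hx, hxR⟩
  obtain ⟨γ, h1, h2⟩ := hS R hR x hxR
  have hγ := hg (γ • o) (MulAction.mem_orbit o γ)
  refine ⟨(γ • o, (g (γ • o))⁻¹ • x), ⟨⟨MulAction.mem_orbit o γ, h1⟩, ?_, ?_⟩, ?_⟩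
  · exact MulAction.mem_orbit_of_mem_orbit _ hx
  · rw [Metric.mem_closedBall, ← dist_smul (g (γ • o)), smul_inv_smul, hγ]
    exact h2
  · exact smul_inv_smul _ _

variable (Γ) in
-- Without this bound the real `limsup` could take its default value `0`, and lower bounds along a
-- subsequence would say nothing.
lemma isBoundedUnder_log_ncard_orbit (hgeo : IsRoughlyGeodesic X) (o : X) :
    IsBoundedUnder (· ≤ ·) atTop (fun R : ℝ => 1 / R *
      Real.log ((MulAction.orbit Γ o ∩ Metric.closedBall o R).ncard : ℝ)) := by
  obtain ⟨Q, hQ⟩ := exists_ncard_orbit_closedBall_add_one_le Γ hgeo o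
  set N : ℝ → ℕ := fun R => (MulAction.orbit Γ o ∩ Metric.closedBall o R).ncard with hN
  have hN1 : ∀ {R : ℝ}, 0 ≤ R → 1 ≤ N R := fun hR => one_le_ncard_orbit_inter_closedBall o hR
  have hQ1 : 1 ≤ Q := by
    rcases Nat.eq_zero_or_pos Q with h | h
    · have := hQ 0 le_rfl
      have h2 : 1 ≤ N (0 + 1) := hN1 (by norm_num)
      rw [h, mul_zero] at this
      exact absurd (h2.trans this) (by norm_num)
    · exact h
  have hpow : ∀ n : ℕ, N n ≤ N 0 * Q ^ n := by
    intro n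
    induction n with
    | zero => simp
    | succ n ih =>
      push_cast
      calc N (n + 1) ≤ N n * Q := hQ n n.cast_nonneg
        _ ≤ N 0 * Q ^ n * Q := Nat.mul_le_mul_right _ ih
        _ = N 0 * Q ^ (n + 1) := by ring
  have hlogQ : 0 ≤ Real.log Q := Real.log_nonneg (by exact_mod_cast hQ1)
  have hlogN : 0 ≤ Real.log (N 0) := Real.log_nonneg (by exact_mod_cast hN1 le_rfl)
  refine ⟨Real.log (N 0) + 2 * Real.log Q, eventually_map.2 ?_⟩
  filter_upwards [eventually_ge_atTop 1] with R hR
  have h1 : N R ≤ N 0 * Q ^ ⌈R⌉₊ :=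
    (ncard_orbit_inter_closedBall_mono o (Nat.le_ceil R)).trans (hpow _)
  have h2 : Real.log (N R) ≤ Real.log (N 0) + ⌈R⌉₊ * Real.log Q := by
    rw [← Real.log_pow, ← Real.log_mul (by exact_mod_cast Nat.one_le_iff_ne_zero.1 (hN1 le_rfl))
      (pow_ne_zero _ (by exact_mod_cast (show Q ≠ 0 by omega)))]
    exact Real.log_le_log (by exact_mod_cast hN1 (by linarith)) (by exact_mod_cast h1)
  have h3 : (⌈R⌉₊ : ℝ) ≤ 2 * R := by linarith [Nat.ceil_lt_add_one (show 0 ≤ R by linarith)]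
  rw [one_div, inv_mul_le_iff₀ (by linarith)]
  have h4 := mul_le_mul_of_nonneg_right h3 hlogQ
  have h5 := mul_le_mul_of_nonneg_right hR hlogN
  change Real.log (N R) ≤ _
  linarith

end Upper

/-! Exponentially many orbit points, from a tree with branching at every orbit point. -/

lemma gromovProduct_smul [IsIsometricSMul Γ X] (γ : Γ) (o x y : X) :
    gromovProduct (γ • o) (γ • x) (γ • y) = gromovProduct o x y := by
  simp only [gromovProduct, dist_smul]

lemma IsNonelementary.exists_injective {h : IsStronglyHyperbolic X ε} {o : X}
    (hΓ : IsNonelementary Γ h o) :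
    ∃ ξ : Fin 3 → GromovBoundary h o, Function.Injective ξ ∧ ∀ i, ξ i ∈ limitSet Γ h o := by
  have h3 : (3 : ℕ∞) ≤ (limitSet Γ h o).encard := by
    have := Order.add_one_le_of_lt hΓ
    norm_num at this
    exact this
  obtain ⟨t, ht, hcard⟩ := Set.exists_subset_encard_eq h3
  obtain ⟨x, y, z, hxy, hxz, hyz, rfl⟩ := Set.encard_eq_three.1 hcard
  refine ⟨![x, y, z], ?_, ?_⟩
  · intro i j hij
    fin_cases i <;> fin_cases j <;> simp_all
  · intro i
    apply ht
    fin_cases i <;> simp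

lemma GromovBoundary.eventually_gromovProduct_le {h : IsStronglyHyperbolic X ε} {o : X}
    {a b : GromovSeq o} (hab : mk h a ≠ mk h b) :
    ∀ᶠ K in atTop, ∀ᶠ n in atTop, gromovProduct o (a.1 n) (b.1 n) ≤ K := by
  have hd : 0 < dist (mk h a) (mk h b) := dist_pos.2 hab
  have h1 := (tendsto_atTop_diag (tendsto_visualDist (h := h) a b)).eventually_const_lt
    (half_lt_self hd)
  filter_upwards [eventually_ge_atTop (-Real.log (dist (mk h a) (mk h b) / 2) / ε)] with K hK
  filter_upwards [h1] with n hn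
  refine le_trans ?_ hK
  have h2 := (Real.log_lt_iff_lt_exp (half_pos hd)).2 hn
  rw [le_div_iff₀ h.pos]
  linarith

/-- Take far terms of orbit sequences tending to three distinct limit points. `K` depends only on
the limits, so `L` may afterwards be chosen in terms of `K`. -/
lemma IsNonelementary.exists_orbit_gromovProduct_le {h : IsStronglyHyperbolic X ε} {o : X}
    (hΓ : IsNonelementary Γ h o) :
    ∃ K : ℝ, 0 ≤ K ∧ ∀ L : ℝ, ∃ u : Fin 3 → Γ, (∀ i, L ≤ dist (u i • o) o) ∧
      ∀ i j, i ≠ j → gromovProduct o (u i • o) (u j • o) ≤ K := by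
  obtain ⟨ξ, hinj, hξ⟩ := hΓ.exists_injective
  choose a ha haξ using hξ
  have hK : ∀ᶠ K in atTop, ∀ i j, i ≠ j → ∀ᶠ n in atTop,
      gromovProduct o ((a i).1 n) ((a j).1 n) ≤ K := by
    simp only [eventually_all]
    intro i j hij
    apply GromovBoundary.eventually_gromovProduct_le (h := h)
    rw [haξ, haξ]
    exact hinj.ne hij
  obtain ⟨K, hK, hK0⟩ := (hK.and (eventually_ge_atTop 0)).exists
  refine ⟨K, hK0, fun L => ?_⟩
  have hK' : ∀ᶠ n in atTop, ∀ i j, i ≠ j → gromovProduct o ((a i).1 n) ((a j).1 n) ≤ K := by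
    simpa only [eventually_all] using hK
  have hL : ∀ᶠ n in atTop, ∀ i, L ≤ dist ((a i).1 n) o := by
    rw [eventually_all]
    intro i
    filter_upwards [(tendsto_atTop_diag (a i).2).eventually_ge_atTop L] with n hn
    simpa [gromovProduct] using hn
  obtain ⟨n, h1, h2⟩ := (hK'.and hL).exists
  choose u hu using fun i => ha i n
  refine ⟨u, fun i => ?_, fun i j hij => ?_⟩
  · exact (h2 i).trans_eq (congrArg (dist · o) (hu i).symm)
  · have := h1 i j hij
    rwa [← hu i, ← hu j] at this

/-- The shift `log 2 / ε` is the additive loss in the usual min-inequality for Gromov products: two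
terms below half of a value cannot sum to it. -/
lemma IsStronglyHyperbolic.exp_add_log_two_div (h : IsStronglyHyperbolic X ε) (a : ℝ) :
    Real.exp (-ε * (a + Real.log 2 / ε)) = Real.exp (-ε * a) / 2 := by
  have : -ε * (a + Real.log 2 / ε) = -ε * a - Real.log 2 := by
    have := h.pos.ne'
    field_simp
    ring
  rw [this, Real.exp_sub, Real.exp_log two_pos]

lemma IsStronglyHyperbolic.exp_anti (h : IsStronglyHyperbolic X ε) {a b : ℝ} (hab : a ≤ b) :
    Real.exp (-ε * b) ≤ Real.exp (-ε * a) :=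
  Real.exp_le_exp.2 (mul_le_mul_of_nonpos_left hab (neg_nonpos.2 h.pos.le))

/-- Seen from `x`, at most one of three points with small pairwise Gromov products lies in the
direction of `q`. -/
lemma IsStronglyHyperbolic.exists_pair_gromovProduct_le (h : IsStronglyHyperbolic X ε) {K : ℝ}
    {x : X} {p : Fin 3 → X} (hp : ∀ i j, i ≠ j → gromovProduct x (p i) (p j) ≤ K) (q : X) :
    ∃ i j, i ≠ j ∧ gromovProduct x q (p i) ≤ K + Real.log 2 / ε ∧
      gromovProduct x q (p j) ≤ K + Real.log 2 / ε := by
  have key : ∀ i j, i ≠ j → gromovProduct x q (p i) ≤ K + Real.log 2 / ε ∨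
      gromovProduct x q (p j) ≤ K + Real.log 2 / ε := by
    intro i j hij
    by_contra! hcon
    have hlt : ∀ {a b : ℝ}, a < b → Real.exp (-ε * b) < Real.exp (-ε * a) := fun hab =>
      Real.exp_lt_exp.2 (mul_lt_mul_of_neg_left hab (neg_lt_zero.2 h.pos))
    have h1 := h.exp_le (p i) (p j) q x
    have h2 := h.exp_anti (hp i j hij)
    have h3 := hlt hcon.1
    have h4 := hlt hcon.2
    rw [h.exp_add_log_two_div] at h3 h4
    rw [gromovProduct_comm x (p i) q] at h1
    linarith
  by_cases h0 : gromovProduct x q (p 0) ≤ K + Real.log 2 / ε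
  · rcases key 1 2 (by decide) with h1 | h1
    · exact ⟨0, 1, by decide, h0, h1⟩
    · exact ⟨0, 2, by decide, h0, h1⟩
  · exact ⟨1, 2, by decide, (key 0 1 (by decide)).resolve_left h0,
      (key 0 2 (by decide)).resolve_left h0⟩

/-- `A` is level `n` of the tree rooted at `γ • o`. The last conjunct is the inductive invariant:
descendants stay in the shadow of the root seen from `o`, which keeps sibling subtrees disjoint. -/
lemma exists_finset_orbit_card_ge [IsIsometricSMul Γ X] (h : IsStronglyHyperbolic X ε) {o : X}
    {K T : ℝ} (hK : 0 ≤ K) {u : Fin 3 → Γ}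
    (hlen : ∀ i, 4 * K + 6 * (Real.log 2 / ε) ≤ dist (u i • o) o)
    (hT : ∀ i, dist (u i • o) o ≤ T)
    (hu : ∀ i j, i ≠ j → gromovProduct o (u i • o) (u j • o) ≤ K) (n : ℕ) :
    ∀ γ : Γ, ∃ A : Finset X, 2 ^ n ≤ A.card ∧ ∀ q ∈ A, q ∈ MulAction.orbit Γ o ∧
      dist q o ≤ dist (γ • o) o + n * T ∧
      Real.exp (-ε * gromovProduct o (γ • o) q) ≤
        2 * Real.exp (-ε * (dist (γ • o) o - (K + Real.log 2 / ε))) := by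
  classical
  set c := Real.log 2 / ε with hc
  have hc0 : 0 ≤ c := div_nonneg (Real.log_nonneg one_le_two) h.pos.le
  have hhalf : ∀ a, Real.exp (-ε * (a + c)) = Real.exp (-ε * a) / 2 := h.exp_add_log_two_div
  induction n with
  | zero =>
    intro γ
    refine ⟨{γ • o}, by simp, fun q hq => ?_⟩
    rw [Finset.mem_singleton] at hq
    subst hq
    refine ⟨MulAction.mem_orbit o γ, by simp, ?_⟩
    have h1 : gromovProduct o (γ • o) (γ • o) = dist (γ • o) o := by simp [gromovProduct]
    have h2 := h.exp_anti (show dist (γ • o) o - (K + c) ≤ dist (γ • o) o by linarith)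
    rw [h1]
    linarith [Real.exp_pos (-ε * (dist (γ • o) o - (K + c)))]
  | succ n ih =>
    intro γ
    set x := γ • o with hx
    obtain ⟨i, j, hij, hi, hj⟩ := h.exists_pair_gromovProduct_le (x := x)
      (p := fun i => γ • u i • o) (K := K)
      (fun i j hij => by rw [hx, gromovProduct_smul]; exact hu i j hij) o
    have hdist : ∀ k, dist (γ • u k • o) x = dist (u k • o) o := fun k => by rw [hx, dist_smul]
    -- A step of length at least `4 * K + 6 * c` loses at most `2 * (K + c)` to backtracking.
    have hfar : ∀ k, gromovProduct x o (γ • u k • o) ≤ K + c →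
        dist x o + (2 * K + 4 * c) ≤ dist (γ • u k • o) o := by
      intro k hk
      unfold gromovProduct at hk
      rw [hdist, dist_comm o x, dist_comm o (γ • u k • o)] at hk
      linarith [hlen k]
    -- Uses the identity `(x, y)_o + (o, y)_x = d(o, x)`.
    have hback : ∀ k, gromovProduct x o (γ • u k • o) ≤ K + c →
        Real.exp (-ε * gromovProduct o x (γ • u k • o)) ≤ Real.exp (-ε * (dist x o - (K + c))) := by
      intro k hk
      refine h.exp_anti ?_
      unfold gromovProduct at hk ⊢
      rw [dist_comm o x, dist_comm o (γ • u k • o)] at hk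
      rw [dist_comm x (γ • u k • o)]
      linarith
    choose A hcard hA using fun k => ih (γ * u k)
    simp only [mul_smul] at hA
    -- The gain `2 * K + 4 * c` minus `K + c` leaves `K + 3 * c`; three halvings against the factor
    -- `2` of the invariant give `1/4`.
    have hdeep : ∀ k, gromovProduct x o (γ • u k • o) ≤ K + c → ∀ q ∈ A k,
        Real.exp (-ε * gromovProduct o (γ • u k • o) q) ≤ Real.exp (-ε * (dist x o + K)) / 4 := by
      intro k hk q hq
      have h1 := h.exp_anti (show ((dist x o + K + c) + c) + c ≤
        dist (γ • u k • o) o - (K + c) by linarith [hfar k hk])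
      rw [hhalf, hhalf, hhalf] at h1
      linarith [(hA k q hq).2.2]
    -- A common descendant would force the siblings' exponential below half of `exp (-ε * (dist x o
    -- + K))`, but their product at `o` exceeds the one at `x` by at most `dist x o`.
    have hdisj : Disjoint (A i) (A j) := by
      rw [Finset.disjoint_left]
      intro q hqi hqj
      have h1 := h.exp_le (γ • u i • o) (γ • u j • o) q o
      rw [gromovProduct_comm o q] at h1
      have h2 := hdeep i hi q hqi
      have h3 := hdeep j hj q hqj
      have h4 : gromovProduct o (γ • u i • o) (γ • u j • o) ≤ dist x o + K := by
        have h5 := hu i j hij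
        rw [← gromovProduct_smul γ] at h5
        change gromovProduct x _ _ ≤ K at h5
        unfold gromovProduct at h5 ⊢
        linarith [dist_triangle (γ • u i • o) x o, dist_triangle (γ • u j • o) x o]
      linarith [h.exp_anti h4, Real.exp_pos (-ε * (dist x o + K))]
    have hmem : ∀ k, gromovProduct x o (γ • u k • o) ≤ K + c → ∀ q ∈ A k,
        q ∈ MulAction.orbit Γ o ∧ dist q o ≤ dist x o + (n + 1 : ℕ) * T ∧
        Real.exp (-ε * gromovProduct o x q) ≤ 2 * Real.exp (-ε * (dist x o - (K + c))) := by
      intro k hk q hq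
      refine ⟨(hA k q hq).1, ?_, ?_⟩
      · have h1 := (hA k q hq).2.1
        have h2 := dist_triangle (γ • u k • o) x o
        rw [hdist] at h2
        push_cast
        linarith [hT k]
      · have h1 := h.exp_le x q (γ • u k • o) o
        have h2 := hdeep k hk q hq
        have h3 := h.exp_anti (show dist x o - (K + c) ≤ dist x o + K by linarith)
        linarith [hback k hk, Real.exp_pos (-ε * (dist x o + K))]
    refine ⟨A i ∪ A j, ?_, fun q hq => ?_⟩
    · rw [Finset.card_union_of_disjoint hdisj, pow_succ]
      linarith [hcard i, hcard j]
    · rcases Finset.mem_union.1 hq with hq | hq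
      · exact hmem i hi q hq
      · exact hmem j hj q hq

lemma IsNonelementary.exists_two_pow_le_ncard [ProperSpace X] [IsIsometricSMul Γ X]
    [ProperlyDiscontinuousSMul Γ X] {h : IsStronglyHyperbolic X ε} {o : X}
    (hΓ : IsNonelementary Γ h o) :
    ∃ T : ℝ, 0 < T ∧ ∀ n : ℕ,
      2 ^ n ≤ (MulAction.orbit Γ o ∩ Metric.closedBall o (n * T)).ncard := by
  obtain ⟨K, hK, hL⟩ := hΓ.exists_orbit_gromovProduct_le
  obtain ⟨u, hlen, hu⟩ := hL (4 * K + 6 * (Real.log 2 / ε))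
  have hpos : ∀ i, 0 < dist (u i • o) o := fun i => by
    have : 0 < Real.log 2 / ε := div_pos (Real.log_pos one_lt_two) h.pos
    linarith [hlen i]
  refine ⟨∑ i, dist (u i • o) o, Finset.sum_pos (fun i _ => hpos i) Finset.univ_nonempty,
    fun n => ?_⟩
  obtain ⟨A, hcard, hA⟩ := exists_finset_orbit_card_ge h hK hlen
    (fun i => Finset.single_le_sum (f := fun i => dist (u i • o) o)
      (fun j _ => (hpos j).le) (Finset.mem_univ i)) hu n 1
  refine hcard.trans ?_
  rw [← Set.ncard_coe_finset]
  refine Set.ncard_le_ncard (fun q hq => ⟨(hA q hq).1, ?_⟩) (orbit_inter_closedBall_finite o _)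
  simpa using (hA q hq).2.1

/-- Along the radii `n * T` the quotient is at least `log 2 / T`, which therefore bounds the limsup
from below. -/
lemma IsNonelementary.volumeGrowth_pos [ProperSpace X] [IsIsometricSMul Γ X]
    [ProperlyDiscontinuousSMul Γ X] [CompactSpace (Quotient (MulAction.orbitRel Γ X))]
    {h : IsStronglyHyperbolic X ε} (hgeo : IsRoughlyGeodesic X) {o : X}
    (hΓ : IsNonelementary Γ h o) : 0 < volumeGrowth Γ o := by
  obtain ⟨T, hT, hpow⟩ := hΓ.exists_two_pow_le_ncard
  refine (div_pos (Real.log_pos one_lt_two) hT).trans_le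
    (le_limsup_of_frequently_le ?_ (isBoundedUnder_log_ncard_orbit Γ hgeo o))
  have htend : Tendsto (fun n : ℕ => (n : ℝ) * T) atTop atTop :=
    tendsto_natCast_atTop_atTop.atTop_mul_const hT
  refine htend.frequently (Eventually.frequently ?_)
  filter_upwards [eventually_ge_atTop 1] with n hn
  have hn0 : (0 : ℝ) < n := by exact_mod_cast hn
  have h1 : (n : ℝ) * Real.log 2 ≤
      Real.log ((MulAction.orbit Γ o ∩ Metric.closedBall o (n * T)).ncard : ℝ) := by
    rw [← Real.log_pow]
    exact Real.log_le_log (by positivity) (by exact_mod_cast hpow n)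
  rw [one_div, le_inv_mul_iff₀ (by positivity)]
  refine le_trans (le_of_eq ?_) h1
  field_simp

end Growth

theorem mainTheorem5 {X : Type*} [MetricSpace X] [ProperSpace X] {ε : ℝ}
    (hX : IsStronglyHyperbolic X ε) (hgeo : IsRoughlyGeodesic X)
    {Γ : Type*} [Group Γ] [MulAction Γ X] [IsIsometricSMul Γ X] [ProperlyDiscontinuousSMul Γ X]
    [CompactSpace (Quotient (MulAction.orbitRel Γ X))]
    (o : X) (hΓ : IsNonelementary Γ hX o)
    (s : ℝ) (hs : s ∈ Set.Ico (0 : ℝ) (1 / 2) ∪ Set.Ioc (1 / 2 : ℝ) 1) :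
    ∃ π : Γ →* (Lp ℂ 2 (pattersonSullivan Γ hX o) →L[ℂ] Lp ℂ 2 (pattersonSullivan Γ hX o)),
      IsQuasiRegularRep (pattersonSullivan Γ hX o) s π ∧
      IsExponentialType (orbitLength o) (volumeGrowth Γ o * |1 / 2 - s|) π := by
  have hα : 0 < volumeGrowth Γ o := hΓ.volumeGrowth_pos hgeo
  have hs' : 1 / 2 - s ≠ 0 := by
    rcases hs with hs | hs
    · linarith [hs.2]
    · linarith [hs.1]
  obtain ⟨π, hπ, hnorm⟩ := exists_quasiRegularRep
    (len := fun γ : Γ => volumeGrowth Γ o * orbitLength o γ)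
    (pattersonSullivan_map_smul_le hX o hα.le)
    (fun γ => by rw [orbitLength_inv]) s
  refine ⟨π, hπ, mul_pos hα (abs_pos.2 hs'), 1, one_pos, fun γ => ?_⟩
  rw [one_mul]
  refine (hnorm γ).trans_eq (congrArg Real.exp ?_)
  ring
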